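/- For a set $F\subset\mathbb{C}$ and $\alpha\in\mathbb{C}$, let $F[\alpha]=\{\sum_{j=0}^{n}\varepsilon_j\alpha^j : n\in\mathbb{N},\ (\varepsilon_0,\dots,\varepsilon_n)\in F^{n+1}\}$, where $\mathbb{N}$ is the set of non-negative integers. We say that $\alpha\in\mathbb{C}$ satisfies the height reducing property if there is a finite set $F\subset\mathbb{Z}$ such that $\mathbb{Z}[\alpha]=F[\alpha]$. Let $\alpha\in\mathbb{C}$ be an algebraic number of degree at most $6$ over $\mathbb{Q}$ all of whose conjugates over $\mathbb{Q}$ in $\mathbb{C}$ lie on the unit circle $\{z\in\mathbb{C}:|z|=1\}$. Then $\alpha$ satisfies the height reducing property. -/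

import Mathlib

/-- For `F ⊆ ℂ` and `α ∈ ℂ`, the set `F[α]` of all sums `ε₀ + ε₁ α + ⋯ + εₙ αⁿ` with `n ∈ ℕ`
and `(ε₀, …, εₙ) ∈ Fⁿ⁺¹`. -/
def polyValues (F : Set ℂ) (α : ℂ) : Set ℂ :=
  {z | ∃ (n : ℕ) (ε : Fin (n + 1) → ℂ), (∀ j, ε j ∈ F) ∧ z = ∑ j, ε j * α ^ (j : ℕ)}

/-- `α` satisfies the height reducing property: there is a finite set `F` of rational integers
with `ℤ[α] = F[α]`. -/
def HeightReducing (α : ℂ) : Prop :=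
  ∃ F : Set ℤ, F.Finite ∧
    polyValues (Set.range (Int.cast : ℤ → ℂ)) α = polyValues ((Int.cast : ℤ → ℂ) '' F) α

open Polynomial in
/-- Dividing `P - e` by `X` modulo `f`. -/
theorem exists_eq_add_X_mul_modulo (S : Finset ℂ) (f : ℤ[X])
    (hf : ∀ z ∈ S, aeval z f = 0) (P : ℤ[X]) (e : ℤ) (he : f.coeff 0 ∣ P.coeff 0 - e) :
    ∃ Q : ℤ[X], Q.natDegree ≤ max P.natDegree f.natDegree - 1 ∧
      ∀ z ∈ S, aeval z P = e + z * aeval z Q := by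
  obtain ⟨m, hm⟩ := he
  refine ⟨(P - C e - C m * f).divX, ?_, fun z hz => ?_⟩
  · rw [natDegree_divX_eq_natDegree_tsub_one]
    refine Nat.sub_le_sub_right ((natDegree_sub_le _ _).trans (max_le_max ?_ ?_)) 1
    · exact (natDegree_sub_le _ _).trans (by simp)
    · exact natDegree_C_mul_le _ _
  · have h := congrArg (aeval z) (X_mul_divX_add (P - C e - C m * f))
    have h0 : (P - C e - C m * f).coeff 0 = 0 := by
      rw [coeff_sub, coeff_sub, coeff_C_mul, coeff_C_zero, hm]; ring
    rw [h0] at h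
    rw [map_add, map_mul, aeval_X, map_sub, map_sub, map_mul, hf z hz, aeval_C, aeval_C] at h
    simp only [algebraMap_int_eq, Int.coe_castRingHom, mul_zero, sub_zero, Int.cast_zero, add_zero] at h
    rw [h]; ring

/-- Every residue class modulo `c ≠ 0` has a nonzero representative of absolute value at most `|c|`
whose sign is that of a given real number. -/
theorem exists_signed_residue (c : ℤ) (hc : c ≠ 0) (a : ℤ) (t : ℝ) :
    ∃ e : ℤ, c ∣ a - e ∧ |(e : ℝ)| ≤ |(c : ℝ)| ∧ |t| ≤ e * t := by
  have key : ∀ a : ℤ, ∃ e : ℤ, c ∣ a - e ∧ 1 ≤ e ∧ e ≤ |c| := fun a => by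
    refine ⟨(a - 1) % c + 1, ?_, ?_, ?_⟩
    · have := Int.dvd_self_sub_emod (x := a - 1) (m := c)
      convert this using 1; ring
    · have := Int.emod_nonneg (a - 1) hc; omega
    · have := Int.emod_lt_abs (a - 1) hc; omega
  rcases le_total 0 t with ht | ht
  · obtain ⟨e, h1, h2, h3⟩ := key a
    have h2' : (1 : ℝ) ≤ e := by exact_mod_cast h2
    have h3' : (e : ℝ) ≤ |(c : ℝ)| := by exact_mod_cast h3
    refine ⟨e, h1, ?_, ?_⟩
    · rwa [abs_of_nonneg (by linarith)]
    · rw [abs_of_nonneg ht]; nlinarith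
  · obtain ⟨e, h1, h2, h3⟩ := key (-a)
    have h2' : (1 : ℝ) ≤ e := by exact_mod_cast h2
    have h3' : (e : ℝ) ≤ |(c : ℝ)| := by exact_mod_cast h3
    refine ⟨-e, ?_, ?_, ?_⟩
    · rw [show a - -e = -(-a - e) by ring]; exact h1.neg_right
    · push_cast; rwa [abs_neg, abs_of_nonneg (by linarith)]
    · push_cast; rw [abs_of_nonpos ht]; nlinarith

open Polynomial in
/-- The sum of the squared absolute values of `Q` on `S`. -/
noncomputable def normSqSum (S : Finset ℂ) (Q : ℤ[X]) : ℝ := ∑ z ∈ S, ‖aeval z Q‖ ^ 2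

open Polynomial in
/-- The real part of the sum of `z⁻ᵏ Q(z)` over `z ∈ S`, for `S` on the unit circle. -/
noncomputable def twistedTrace (S : Finset ℂ) (k : ℕ) (Q : ℤ[X]) : ℝ :=
  ∑ z ∈ S, ((starRingEnd ℂ z) ^ k * aeval z Q).re

theorem normSqSum_nonneg (S : Finset ℂ) (Q : Polynomial ℤ) : 0 ≤ normSqSum S Q :=
  Finset.sum_nonneg fun _ _ => sq_nonneg _

open Polynomial in
theorem normSqSum_of_eq_add_mul {S : Finset ℂ} (hS : ∀ z ∈ S, ‖z‖ = 1) {P Q : ℤ[X]} {e : ℤ}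
    (h : ∀ z ∈ S, aeval z P = e + z * aeval z Q) :
    normSqSum S Q = normSqSum S P - 2 * (e * twistedTrace S 0 P) + S.card * (e : ℝ) ^ 2 := by
  have : ∀ z ∈ S, ‖aeval z Q‖ ^ 2 =
      ‖aeval z P‖ ^ 2 - 2 * (e * ((starRingEnd ℂ z) ^ 0 * aeval z P).re) + (e : ℝ) ^ 2 := by
    intro z hz
    have h1 : ‖aeval z Q‖ = ‖aeval z P - e‖ := by
      rw [h z hz, add_sub_cancel_left, norm_mul, hS z hz, one_mul]
    rw [h1, Complex.sq_norm, Complex.sq_norm, Complex.normSq_apply, Complex.normSq_apply]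
    simp
    ring
  rw [normSqSum, Finset.sum_congr rfl this, Finset.sum_add_distrib, Finset.sum_sub_distrib,
    ← Finset.mul_sum, ← Finset.mul_sum, Finset.sum_const, nsmul_eq_mul]
  rfl

open Polynomial in
theorem abs_twistedTrace_of_eq_add_mul {S : Finset ℂ} (hS : ∀ z ∈ S, ‖z‖ = 1) {P Q : ℤ[X]}
    {e : ℤ} (h : ∀ z ∈ S, aeval z P = e + z * aeval z Q) (k : ℕ) :
    |twistedTrace S (k + 1) P| ≤ |twistedTrace S k Q| + S.card * |(e : ℝ)| := by
  have h1 : ∀ z ∈ S, ((starRingEnd ℂ z) ^ (k + 1) * aeval z P).re =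
      ((starRingEnd ℂ z) ^ k * aeval z Q).re + ((starRingEnd ℂ z) ^ (k + 1) * e).re := by
    intro z hz
    rw [← Complex.add_re, h z hz]
    have : starRingEnd ℂ z * z = 1 := by
      rw [Complex.conj_mul', hS z hz]; simp
    congr 1
    linear_combination (starRingEnd ℂ z) ^ k * aeval z Q * this
  have h2 : |∑ z ∈ S, ((starRingEnd ℂ z) ^ (k + 1) * e).re| ≤ S.card * |(e : ℝ)| := by
    refine (Finset.abs_sum_le_sum_abs _ _).trans ?_
    rw [← nsmul_eq_mul]
    refine Finset.sum_le_card_nsmul _ _ _ fun z hz => (Complex.abs_re_le_norm _).trans ?_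
    rw [norm_mul, norm_pow, RCLike.norm_conj, hS z hz, one_pow, one_mul, Complex.norm_intCast]
  rw [twistedTrace, Finset.sum_congr rfl h1, Finset.sum_add_distrib]
  exact (abs_add_le _ _).trans (add_le_add le_rfl h2)

open Polynomial in
theorem normSqSum_eq_sum_coeff_mul {S : Finset ℂ} {Q : ℤ[X]} {d : ℕ} (hQ : Q.natDegree < d) :
    normSqSum S Q = ∑ k ∈ Finset.range d, (Q.coeff k : ℝ) * twistedTrace S k Q := by
  have h : ∀ z ∈ S, ‖aeval z Q‖ ^ 2 = ∑ k ∈ Finset.range d,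
      (Q.coeff k : ℝ) * ((starRingEnd ℂ z) ^ k * aeval z Q).re := by
    intro z _
    have h1 : ((‖aeval z Q‖ ^ 2 : ℝ) : ℂ) = ∑ k ∈ Finset.range d,
        (Q.coeff k : ℂ) * ((starRingEnd ℂ z) ^ k * aeval z Q) := by
      have h2 : starRingEnd ℂ (aeval z Q) =
          ∑ k ∈ Finset.range d, (Q.coeff k : ℂ) * (starRingEnd ℂ z) ^ k := by
        rw [aeval_eq_sum_range' hQ, map_sum]
        simp
      rw [Complex.ofReal_pow, ← Complex.conj_mul', h2, Finset.sum_mul]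
      simp only [mul_assoc]
    have h3 := congrArg Complex.re h1
    rw [Complex.ofReal_re, Complex.re_sum] at h3
    rw [h3]
    refine Finset.sum_congr rfl fun k _ => ?_
    rw [← Complex.ofReal_intCast, Complex.re_ofReal_mul]
  rw [normSqSum, Finset.sum_congr rfl h, Finset.sum_comm]
  simp only [twistedTrace, Finset.mul_sum]

open Polynomial in
theorem exists_abs_coeff_le_mul_sqrt_normSqSum (S : Finset ℂ) :
    ∃ A : ℝ, 0 ≤ A ∧ ∀ Q : ℤ[X], Q.natDegree < S.card → ∀ k,
      |(Q.coeff k : ℝ)| ≤ A * √(normSqSum S Q) := by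
  refine ⟨∑ k ∈ Finset.range S.card, ∑ z ∈ S, ‖(Lagrange.basis S id z).coeff k‖,
    by positivity, fun Q hQ k => ?_⟩
  rcases le_or_gt S.card k with hk | hk
  · rw [coeff_eq_zero_of_natDegree_lt (hQ.trans_le hk)]
    simp only [Int.cast_zero, abs_zero]
    positivity
  have hcoeff : (Q.coeff k : ℂ) = ∑ z ∈ S, aeval z Q * (Lagrange.basis S id z).coeff k := by
    have hd : (Q.map (algebraMap ℤ ℂ)).degree < S.card :=
      degree_map_le.trans_lt (degree_le_natDegree.trans_lt (by exact_mod_cast hQ))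
    have h := Lagrange.eq_interpolate (s := S) (v := id) (Set.injOn_id _) hd
    have h' := congrArg (fun p => coeff p k) h
    simpa [Lagrange.interpolate_apply, finsetSum_coeff, ← eval_map_algebraMap] using h'
  have hle : ∀ z ∈ S, ‖aeval z Q‖ ≤ √(normSqSum S Q) := fun z hz => by
    apply Real.le_sqrt_of_sq_le
    exact Finset.single_le_sum (f := fun z => ‖aeval z Q‖ ^ 2) (fun _ _ => sq_nonneg _) hz
  have h1 : |(Q.coeff k : ℝ)| ≤
      (∑ z ∈ S, ‖(Lagrange.basis S id z).coeff k‖) * √(normSqSum S Q) := by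
    rw [← Complex.norm_intCast, hcoeff, Finset.sum_mul]
    refine norm_sum_le_of_le _ fun z hz => ?_
    rw [norm_mul, mul_comm]
    exact mul_le_mul_of_nonneg_left (hle z hz) (norm_nonneg _)
  refine h1.trans (mul_le_mul_of_nonneg_right ?_ (Real.sqrt_nonneg _))
  exact Finset.single_le_sum (f := fun k => ∑ z ∈ S, ‖(Lagrange.basis S id z).coeff k‖)
    (fun _ _ => by positivity) (Finset.mem_range.2 hk)

open Polynomial in
/-- `P` agrees on `S` with an integer polynomial of height at most `M`. -/
def HasSmallRep (S : Finset ℂ) (M : ℤ) (P : ℤ[X]) : Prop :=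
  ∃ R : ℤ[X], (∀ i, |R.coeff i| ≤ M) ∧ ∀ z ∈ S, aeval z P = aeval z R

open Polynomial in
theorem HasSmallRep.of_eq_add_mul {S : Finset ℂ} {M : ℤ} {P Q : ℤ[X]} {e : ℤ} (he : |e| ≤ M)
    (h : ∀ z ∈ S, aeval z P = e + z * aeval z Q) (hQ : HasSmallRep S M Q) :
    HasSmallRep S M P := by
  obtain ⟨R, hR, hQR⟩ := hQ
  refine ⟨C e + X * R, fun i => ?_, fun z hz => ?_⟩
  · cases i with
    | zero => rwa [coeff_add, coeff_C_zero, coeff_X_mul_zero, add_zero]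
    | succ i => rw [coeff_add, coeff_C_succ, coeff_X_mul, zero_add]; exact hR i
  · rw [h z hz, hQR z hz]; simp

open Polynomial in
/-- After `j` division steps with signed digits, the squared norm has dropped by at least the
double of each of the first `j` twisted traces, up to a bounded error. -/
theorem exists_descent {S : Finset ℂ} (hS : ∀ z ∈ S, ‖z‖ = 1) {f : ℤ[X]}
    (hf : ∀ z ∈ S, aeval z f = 0) (hf0 : f.coeff 0 ≠ 0) (hd0 : 0 < S.card)
    (hd : f.natDegree ≤ S.card) {M : ℤ} (hM : |f.coeff 0| ≤ M) (j : ℕ) :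
    ∀ P : ℤ[X], P.natDegree < S.card → ∃ Q : ℤ[X], Q.natDegree < S.card ∧
      (HasSmallRep S M Q → HasSmallRep S M P) ∧
      normSqSum S Q ≤ normSqSum S P +
        j * (S.card * |(f.coeff 0 : ℝ)| ^ 2 + 2 * (S.card * |(f.coeff 0 : ℝ)|)) ∧
      ∀ k < j, normSqSum S Q ≤ normSqSum S P +
        j * (S.card * |(f.coeff 0 : ℝ)| ^ 2 + 2 * (S.card * |(f.coeff 0 : ℝ)|))
          - 2 * |twistedTrace S k P| := by
  induction j with
  | zero => exact fun P hP => ⟨P, hP, id, by simp, by simp⟩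
  | succ j ih =>
    intro P hP
    obtain ⟨e, hdvd, hec, het⟩ :=
      exists_signed_residue (f.coeff 0) hf0 (P.coeff 0) (twistedTrace S 0 P)
    obtain ⟨P', hP', h⟩ := exists_eq_add_X_mul_modulo S f hf P e hdvd
    obtain ⟨Q, hQ, hrep, hN, hT⟩ := ih P' (by omega)
    have heM : |e| ≤ M := le_trans (by exact_mod_cast hec) hM
    have hsq : S.card * (e : ℝ) ^ 2 ≤ S.card * |(f.coeff 0 : ℝ)| ^ 2 := by
      rw [← sq_abs (e : ℝ)]; gcongr
    have hlin : S.card * |(e : ℝ)| ≤ S.card * |(f.coeff 0 : ℝ)| := by gcongr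
    have hpos : 0 ≤ S.card * |(f.coeff 0 : ℝ)| := by positivity
    have hstep := normSqSum_of_eq_add_mul hS h
    have hT0 := abs_nonneg (twistedTrace S 0 P)
    refine ⟨Q, hQ, fun hq => (hrep hq).of_eq_add_mul heM h, ?_, fun k hk => ?_⟩
    · push_cast
      linarith
    · push_cast
      cases k with
      | zero => linarith
      | succ k =>
        have h1 := hT k (by omega)
        have h2 := abs_twistedTrace_of_eq_add_mul hS h k
        linarith

open Polynomial in
/-- Integer polynomials can be replaced, on a finite set of points of the unit circle that are
roots of an integer polynomial of degree equal to their number, by ones of bounded height. -/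
theorem exists_hasSmallRep {S : Finset ℂ} (hS : ∀ z ∈ S, ‖z‖ = 1) {f : ℤ[X]}
    (hf : ∀ z ∈ S, aeval z f = 0) (hf0 : f.coeff 0 ≠ 0) (hd0 : 0 < S.card)
    (hd : f.natDegree ≤ S.card) : ∃ M : ℤ, ∀ P : ℤ[X], HasSmallRep S M P := by
  obtain ⟨A, hA, hcoeff⟩ := exists_abs_coeff_le_mul_sqrt_normSqSum S
  set K : ℝ := S.card * |(f.coeff 0 : ℝ)| ^ 2 + 2 * (S.card * |(f.coeff 0 : ℝ)|) with hK
  set L : ℝ := (S.card * K + 1) / 2 with hL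
  have hL0 : 0 ≤ L := by positivity
  set B : ℝ := S.card * (A * L) with hB
  have hB0 : 0 ≤ B := by positivity
  set M : ℤ := max |f.coeff 0| ⌈A * B⌉ with hM
  have hfM : |f.coeff 0| ≤ M := le_max_left _ _
  have low : ∀ n : ℕ, ∀ P : ℤ[X], P.natDegree < S.card → normSqSum S P < n →
      HasSmallRep S M P := by
    intro n
    induction n with
    | zero =>
      intro P _ h
      have := normSqSum_nonneg S P
      push_cast at h
      linarith
    | succ n ih =>
      intro P hP hn
      by_cases htr : ∀ k < S.card, |twistedTrace S k P| ≤ L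
      · have h1 : normSqSum S P ≤ B * √(normSqSum S P) := by
          conv_lhs => rw [normSqSum_eq_sum_coeff_mul hP]
          calc _ ≤ ∑ k ∈ Finset.range S.card, A * √(normSqSum S P) * L := by
                refine Finset.sum_le_sum fun k hk => (le_abs_self _).trans ?_
                rw [abs_mul]
                exact mul_le_mul (hcoeff P hP k) (htr k (Finset.mem_range.1 hk))
                  (abs_nonneg _) (by positivity)
            _ = _ := by rw [Finset.sum_const, Finset.card_range, nsmul_eq_mul]; ring
        have h2 : √(normSqSum S P) ≤ B := by
          by_contra! hlt
          have := Real.mul_self_sqrt (normSqSum_nonneg S P)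
          nlinarith
        refine ⟨P, fun i => ?_, fun _ _ => rfl⟩
        have h3 : |(P.coeff i : ℝ)| ≤ ⌈A * B⌉ :=
          ((hcoeff P hP i).trans (mul_le_mul_of_nonneg_left h2 hA)).trans (Int.le_ceil _)
        exact le_trans (by exact_mod_cast h3) (le_max_right _ _)
      · push Not at htr
        obtain ⟨k, hk, hlt⟩ := htr
        obtain ⟨Q, hQ, hrep, -, hT⟩ := exists_descent hS hf hf0 hd0 hd hfM S.card P hP
        refine hrep (ih Q hQ ?_)
        have := hT k hk
        push_cast at hn
        linarith
  refine ⟨M, fun P => ?_⟩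
  induction hn : P.natDegree using Nat.strong_induction_on generalizing P with
  | _ n ih =>
    by_cases hP : P.natDegree < S.card
    · obtain ⟨m, hm⟩ := exists_nat_gt (normSqSum S P)
      exact low m P hP hm
    · obtain ⟨e, hdvd, hec, -⟩ := exists_signed_residue (f.coeff 0) hf0 (P.coeff 0) 0
      obtain ⟨Q, hQ, h⟩ := exists_eq_add_X_mul_modulo S f hf P e hdvd
      exact (ih _ (by omega) Q rfl).of_eq_add_mul (le_trans (by exact_mod_cast hec) hfM) h

open Polynomial in
theorem exists_aeval_eq_of_mem_polyValues {α z : ℂ}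
    (hz : z ∈ polyValues (Set.range (Int.cast : ℤ → ℂ)) α) : ∃ P : ℤ[X], aeval α P = z := by
  obtain ⟨n, ε, hε, rfl⟩ := hz
  choose e he using hε
  exact ⟨∑ j, C (e j) * X ^ (j : ℕ), by simp [he]⟩

open Polynomial in
theorem aeval_mem_polyValues (α : ℂ) {F : Set ℤ} {R : ℤ[X]} (hR : ∀ i, R.coeff i ∈ F) :
    aeval α R ∈ polyValues ((Int.cast : ℤ → ℂ) '' F) α := by
  refine ⟨R.natDegree, fun j => R.coeff j, fun j => ⟨_, hR j, rfl⟩, ?_⟩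
  rw [aeval_eq_sum_range, Fin.sum_univ_eq_sum_range (fun j => (R.coeff j : ℂ) * α ^ j)]
  simp

theorem polyValues_mono {F G : Set ℂ} (h : F ⊆ G) (α : ℂ) : polyValues F α ⊆ polyValues G α :=
  fun _ ⟨n, ε, hε, hz⟩ => ⟨n, ε, fun j => h (hε j), hz⟩

open Polynomial in
theorem heightReducing_of_forall_isConjRoot_norm_eq_one {α : ℂ} (halg : IsAlgebraic ℚ α)
    (hcircle : ∀ β : ℂ, IsConjRoot ℚ α β → ‖β‖ = 1) : HeightReducing α := by
  have hint : IsIntegral ℚ α := halg.isIntegral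
  have hp0 : minpoly ℚ α ≠ 0 := minpoly.ne_zero hint
  set S : Finset ℂ := ((minpoly ℚ α).aroots ℂ).toFinset with hSdef
  have hmem : ∀ z, z ∈ S ↔ aeval z (minpoly ℚ α) = 0 := fun z => by
    simp [hSdef, hp0]
  have hS : ∀ z ∈ S, ‖z‖ = 1 := fun z hz =>
    hcircle z ((isConjRoot_iff_aeval_eq_zero hint).2 ((hmem z).1 hz))
  have hαS : α ∈ S := (hmem α).2 (minpoly.aeval ℚ α)
  have hcard : S.card = (minpoly ℚ α).natDegree := by
    rw [hSdef, Multiset.toFinset_card_of_nodup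
      (nodup_roots (minpoly.irreducible hint).separable.map),
      ← (IsAlgClosed.splits ((minpoly ℚ α).map (algebraMap ℚ ℂ))).natDegree_eq_card_roots,
      natDegree_map]
  obtain ⟨b, hb, hfb⟩ :=
    IsLocalization.integerNormalization_spec (nonZeroDivisors ℤ) (minpoly ℚ α)
  set f : ℤ[X] := IsLocalization.integerNormalization (nonZeroDivisors ℤ) (minpoly ℚ α)
  have hf : ∀ z ∈ S, aeval z f = 0 := fun z hz =>
    IsLocalization.integerNormalization_aeval_eq_zero _ _ ((hmem z).1 hz)
  have hinj : Function.Injective (algebraMap ℤ ℚ) := (algebraMap ℤ ℚ).injective_int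
  have hd : f.natDegree ≤ S.card := by
    rw [hcard, ← natDegree_map_eq_of_injective hinj, hfb]
    exact natDegree_smul_le _ _
  have hf0 : f.coeff 0 ≠ 0 := fun h => by
    have h1 := congrArg (fun p => coeff p 0) hfb
    have hα : α = 0 := by
      simpa [h, nonZeroDivisors.ne_zero hb, minpoly.coeff_zero_eq_zero hint] using h1.symm
    have := hS α hαS
    simp [hα] at this
  obtain ⟨M, hM⟩ := exists_hasSmallRep hS hf hf0 (Finset.card_pos.2 ⟨α, hαS⟩) hd
  refine ⟨Set.Icc (-M) M, Set.finite_Icc _ _, Set.Subset.antisymm (fun z hz => ?_)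
    (polyValues_mono (Set.image_subset_range _ _) α)⟩
  obtain ⟨P, rfl⟩ := exists_aeval_eq_of_mem_polyValues hz
  obtain ⟨R, hR, hPR⟩ := hM P
  rw [hPR α hαS]
  exact aeval_mem_polyValues α fun i => abs_le.1 (hR i)

theorem mainTheorem3 (α : ℂ) (halg : IsAlgebraic ℚ α)
    (hcircle : ∀ β : ℂ, IsConjRoot ℚ α β → ‖β‖ = 1)
    (hdeg : (minpoly ℚ α).natDegree ≤ 6) :
    HeightReducing α :=
  heightReducing_of_forall_isConjRoot_norm_eq_one halg hcircle
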